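/- For a finite-dimensional space $\mathbb R^d$ let $\mathcal P(\mathbb R^d)$ be the set of probability measures on $\mathbb R^d$ with finite moments of arbitrary order. For $X\in\mathcal P(\mathbb R^d)$ and an integer $N\ge 1$ write $Y\sim_N X$ if $Y=\frac1N\sum_{i=1}^N\delta_{x_i}$ is the empirical distribution of $N$ independent samples $x_1,\dots,x_N$ of $X$. For $G:\mathcal P(\mathbb R^d)\to\mathbb R$ let $[\mathcal S G](X)=\mathbb E_{Y\sim_N X}[G(Y)]$ be the resampling operator. For a fixed functional $F$ let $[\mathcal B G](X)=F(X)-\big(\mathbb E_{Y\sim_N X}[G(Y)]-G(X)\big)$ be the bootstrap operator, and call $\mathcal B^kF$ (that is, $\mathcal B$ applied $k$ times, starting from $F$) the $k$-times iterated bootstrap. **Corollary (inverse of average linear systems).** Let $n,N\ge 1$, $0<\sigma<1$, and let $A\in\mathbb R^{n\times n}$ be a random matrix which almost surely is symmetric with all its eigenvalues in $(0,\sigma)$. Let $X\in\mathcal P(\mathbb R^{n^2})$ be the distribution of $A$, and let $$F(X)=\operatorname{tr}\big[(\mathrm{Id}+\mathbb E_{A\sim X}[A])^{-1}\big],$$ where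 $\operatorname{tr}M=\frac1n\sum_{i=1}^nM_{ii}$ is the normalized trace. Put $k=\big\lfloor-\sqrt{N/8}\,\log\sigma\big\rfloor$ (natural logarithm). Then, for all $0\le j\le k$, the functionals $(\mathrm{Id}-\mathcal S)^jF$ and $\mathcal B^jF$, evaluated at $Y\sim_N X$, are integrable; the bias of the $k$-times iterated bootstrap is $$\mathbb E_{Y\sim_N X}\big[[\mathcal B^kF](Y)\big]-F(X)=-\big[(\mathrm{Id}-\mathcal S)^{k+1}F\big](X),$$ and it satisfies $$\Big|\big[(\mathrm{Id}-\mathcal S)^{k+1}F\big](X)\Big|\le\frac{4}{1-\sigma}\,\sigma^{\sqrt{N/32}}.$$ -/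

import Mathlib

open MeasureTheory

noncomputable section

namespace BootstrapBias

/-- `𝒫(ℝ^ι)`: the probability measures on `ℝ^ι` with finite moments of arbitrary order. -/
def MomentMeasure (ι : Type) [Fintype ι] : Type :=
  {μ : Measure (ι → ℝ) // IsProbabilityMeasure μ ∧ ∀ p : ℕ, Integrable (fun x => ‖x‖ ^ p) μ}

/-- The empirical measure `(1/N) ∑ᵢ δ_{xᵢ}` of the data points `x₁, …, x_N`. -/
def empiricalMeasure {ι : Type} {N : ℕ} (x : Fin N → ι → ℝ) : Measure (ι → ℝ) :=
  (N : ENNReal)⁻¹ • ∑ i, Measure.dirac (x i)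

theorem isProbabilityMeasure_empiricalMeasure {ι : Type} {N : ℕ} [NeZero N]
    (x : Fin N → ι → ℝ) : IsProbabilityMeasure (empiricalMeasure x) := by
  constructor
  simp [empiricalMeasure, ENNReal.inv_mul_cancel (Nat.cast_ne_zero.2 (NeZero.ne N))
    (ENNReal.natCast_ne_top N)]

theorem integrable_empiricalMeasure {ι : Type} [Fintype ι] {N : ℕ} [NeZero N]
    (x : Fin N → ι → ℝ) (f : (ι → ℝ) → ℝ) : Integrable f (empiricalMeasure x) := by
  refine Integrable.smul_measure ?_ (ENNReal.inv_ne_top.2 (Nat.cast_ne_zero.2 (NeZero.ne N)))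
  rw [integrable_finsetSum_measure]
  intro i _
  exact integrable_dirac (by simp)

/-- The empirical distribution of `N ≥ 1` data points, as an element of `𝒫(ℝ^ι)`. -/
def empirical {ι : Type} [Fintype ι] {N : ℕ} [NeZero N] (x : Fin N → ι → ℝ) : MomentMeasure ι :=
  ⟨empiricalMeasure x, isProbabilityMeasure_empiricalMeasure x,
    fun _ => integrable_empiricalMeasure x _⟩

/-- The resampling operator `[𝒮 G](X) = 𝔼_{Y ∼_N X}[G(Y)]`, where `Y` is the empirical
distribution of `N` independent samples from `X`. -/
def resample {ι : Type} [Fintype ι] (N : ℕ) [NeZero N] (G : MomentMeasure ι → ℝ) :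
    MomentMeasure ι → ℝ :=
  fun X => ∫ x, G (empirical x) ∂(Measure.pi fun _ : Fin N => X.1)

/-- The operator `Id - 𝒮`. -/
def idSubResample {ι : Type} [Fintype ι] (N : ℕ) [NeZero N] (G : MomentMeasure ι → ℝ) :
    MomentMeasure ι → ℝ :=
  fun X => G X - resample N G X

/-- The affine bootstrap operator of `F`,
`[ℬ G](X) = F(X) - (𝔼_{Y ∼_N X}[G(Y)] - G(X))`. -/
def bootstrap {ι : Type} [Fintype ι] (N : ℕ) [NeZero N] (F G : MomentMeasure ι → ℝ) :
    MomentMeasure ι → ℝ :=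
  fun X => F X - (resample N G X - G X)

/-- The `k`-times iterated bootstrap `ℬᵏ F`. -/
def iteratedBootstrap {ι : Type} [Fintype ι] (N : ℕ) [NeZero N] (k : ℕ)
    (F : MomentMeasure ι → ℝ) : MomentMeasure ι → ℝ :=
  (bootstrap N F)^[k] F

/-- A point of `ℝ^(n²)` read as an `n × n` matrix. -/
def toMatrix {n : ℕ} (x : Fin n × Fin n → ℝ) : Matrix (Fin n) (Fin n) ℝ :=
  Matrix.of fun i j => x (i, j)

/-- The entrywise expectation `𝔼_{A ∼ X}[A]`. -/
def meanMatrix {n : ℕ} (X : MomentMeasure (Fin n × Fin n)) : Matrix (Fin n) (Fin n) ℝ :=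
  Matrix.of fun i j => ∫ x, toMatrix x i j ∂X.1

/-- The normalized trace `tr M = (1/n) ∑ᵢ Mᵢᵢ`, so that `tr Id = 1`. -/
def normalizedTrace {n : ℕ} (M : Matrix (Fin n) (Fin n) ℝ) : ℝ :=
  (n : ℝ)⁻¹ * M.trace

/-- The functional `F(X) = tr (Id + 𝔼_{A ∼ X}[A])⁻¹`, with the normalized trace. -/
def traceInverse {n : ℕ} (X : MomentMeasure (Fin n × Fin n)) : ℝ :=
  normalizedTrace (1 + meanMatrix X)⁻¹

end BootstrapBias

end

/-! ### Algebra of the operator `Id - 𝒮` and the bias of the iterated bootstrap. -/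

noncomputable section

namespace BootstrapBias

variable {ι : Type} [Fintype ι] {N : ℕ} [NeZero N] {B : Set (ι → ℝ)}

/-! The iterate `ℬᵏF` is the partial Neumann sum `∑_{i ≤ k} (Id - 𝒮)ⁱF` for `𝒮⁻¹F`, so its bias
telescopes to `-(Id - 𝒮)^(k+1) F` (`bias_iteratedBootstrap`).

For the bound, consider a functional `𝔼 h(y_{g(1)}, …, y_{g(m)})` of independent samples. Resampling
replaces `g` by `f ∘ g` with `f` a uniform random map to `Fin N`. The functional changes only if `f`
identifies two of the indices in use, which has probability at most `m²/(2N)`. Hence `(Id - 𝒮)ʲ`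
gains a factor `(m²/N)ʲ` (`abs_idSubResample_iterate_sampleMean_le`).

The Neumann series of `(Id + 𝔼A)⁻¹` writes `F` as an alternating sum of such functionals, with `h =
tr(y₁⋯y_m)` bounded by `σᵐ`. Cut it at `R = ⌈√(N/2)⌉`: below the cut each application of `Id - 𝒮`
halves the bound; the tail has size `σᴿ/(1 - σ)` and grows at most by a factor 2 each time. The
choice of `k` balances `2^{-(k+1)}` against `2^{k+1} σᴿ`. -/

instance (X : MomentMeasure ι) : IsProbabilityMeasure X.1 := X.2.1

/-- `X` gives full measure to `B`. -/
def SupportedIn (B : Set (ι → ℝ)) (X : MomentMeasure ι) : Prop := ∀ᵐ x ∂X.1, x ∈ B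

/-- Functionals which depend measurably on the data points of an empirical measure, and boundedly
so as long as the data points lie in `B`. -/
structure Admissible (N : ℕ) [NeZero N] (B : Set (ι → ℝ)) (G : MomentMeasure ι → ℝ) : Prop where
  measurable : Measurable fun x : Fin N → ι → ℝ => G (empirical x)
  bounded : ∃ C, ∀ x : Fin N → ι → ℝ, (∀ i, x i ∈ B) → |G (empirical x)| ≤ C

theorem SupportedIn.ae_pi {X : MomentMeasure ι} (hX : SupportedIn B X) {κ : Type} [Fintype κ] :
    ∀ᵐ y ∂(Measure.pi fun _ : κ => X.1), ∀ i, y i ∈ B := by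
  rw [ae_all_iff]
  intro i
  exact (Measure.tendsto_eval_ae_ae (μ := fun _ : κ => X.1) (i := i)).eventually hX

/-- Makes the support condition stable under sampling, so that identities and bounds valid only on
`B` can be used under `𝒮`. -/
theorem supportedIn_empirical {x : Fin N → ι → ℝ} (hx : ∀ i, x i ∈ B) :
    SupportedIn B (empirical x) := by
  change ∀ᵐ y ∂(empiricalMeasure x), y ∈ B
  refine Measure.ae_smul_measure ?_ _
  rw [← Measure.sum_fintype, Measure.ae_sum_iff]
  intro i
  rw [ae_dirac_eq]
  exact hx i

/-- On a box, the product over `κ` of sums over `Fin N` expands into a sum over all maps `f`. -/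
theorem pi_empiricalMeasure (x : Fin N → ι → ℝ) (κ : Type) [Fintype κ] [DecidableEq κ] :
    Measure.pi (fun _ : κ => empiricalMeasure x) =
      ((N : ENNReal)⁻¹) ^ Fintype.card κ • ∑ f : κ → Fin N, Measure.dirac (x ∘ f) := by
  have := isProbabilityMeasure_empiricalMeasure x
  refine (Measure.pi_eq fun s hs => ?_)
  have h : ∀ f : κ → Fin N, Measure.dirac (x ∘ f) (Set.univ.pi s) =
      ∏ i, (s i).indicator 1 (x (f i)) := by
    intro f
    rw [Measure.dirac_apply' _ (MeasurableSet.univ_pi hs)]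
    by_cases hf : ∀ i, x (f i) ∈ s i
    · rw [Set.indicator_of_mem (by simpa [Set.mem_univ_pi] using hf)]
      simp [hf]
    · rw [Set.indicator_of_notMem (by simpa [Set.mem_univ_pi] using hf)]
      push Not at hf
      obtain ⟨i, hi⟩ := hf
      exact (Finset.prod_eq_zero (Finset.mem_univ i) (by simp [hi])).symm
  simp only [Measure.smul_apply, Measure.finsetSum_apply, h, empiricalMeasure, smul_eq_mul]
  rw [Finset.prod_mul_distrib, Finset.prod_const, Finset.card_univ]
  simp_rw [Measure.dirac_apply' _ (hs _)]
  rw [Finset.prod_univ_sum, Fintype.piFinset_univ]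

theorem integral_pi_empirical (x : Fin N → ι → ℝ) (κ : Type) [Fintype κ] [DecidableEq κ] (H : (κ → ι → ℝ) → ℝ) :
    ∫ y, H y ∂(Measure.pi fun _ : κ => (empirical x).1) =
      ((N : ℝ)⁻¹) ^ Fintype.card κ * ∑ f : κ → Fin N, H (x ∘ f) := by
  change ∫ y, H y ∂(Measure.pi fun _ : κ => empiricalMeasure x) = _
  rw [pi_empiricalMeasure, integral_smul_measure, integral_finsetSum_measure]
  · simp
  · intro f _
    -- Every real function is integrable for a point mass here, so `H` needs no measurability.
    exact integrable_dirac (by simp)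

theorem resample_empirical (G : MomentMeasure ι → ℝ) (x : Fin N → ι → ℝ) :
    resample N G (empirical x) =
      ((N : ℝ)⁻¹) ^ N * ∑ f : Fin N → Fin N, G (empirical (x ∘ f)) := by
  rw [resample, integral_pi_empirical, Fintype.card_fin]

namespace Admissible

variable {G H : MomentMeasure ι → ℝ}

theorem integrable (hG : Admissible N B G) {X : MomentMeasure ι} (hX : SupportedIn B X) :
    Integrable (fun x => G (empirical x)) (Measure.pi fun _ : Fin N => X.1) := by
  obtain ⟨C, hC⟩ := hG.bounded
  exact Integrable.of_bound hG.measurable.aestronglyMeasurable C (hX.ae_pi.mono hC)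

theorem add_const_mul (hG : Admissible N B G) (hH : Admissible N B H) (c : ℝ) :
    Admissible N B fun X => G X + c * H X := by
  obtain ⟨C, hC⟩ := hG.bounded
  obtain ⟨D, hD⟩ := hH.bounded
  refine ⟨hG.measurable.add (hH.measurable.const_mul c), C + |c| * D, fun x hx => ?_⟩
  refine (abs_add_le _ _).trans (add_le_add (hC x hx) ?_)
  rw [abs_mul]
  exact mul_le_mul_of_nonneg_left (hD x hx) (abs_nonneg c)

theorem zero : Admissible N B fun _ => 0 := ⟨measurable_const, 0, by simp⟩

theorem const_mul (hG : Admissible N B G) (c : ℝ) : Admissible N B fun X => c * G X := by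
  simpa using zero.add_const_mul hG c

theorem add (hG : Admissible N B G) (hH : Admissible N B H) :
    Admissible N B fun X => G X + H X := by
  simpa using hG.add_const_mul hH 1

theorem sub (hG : Admissible N B G) (hH : Admissible N B H) :
    Admissible N B fun X => G X - H X := by
  simpa [sub_eq_add_neg] using hG.add_const_mul hH (-1)

theorem sum {α : Type*} (s : Finset α) {G : α → MomentMeasure ι → ℝ}
    (hG : ∀ a ∈ s, Admissible N B (G a)) : Admissible N B fun X => ∑ a ∈ s, G a X := by
  classical
  induction s using Finset.induction_on with
  | empty => simpa using zero
  | insert a s ha ih =>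
    simp_rw [Finset.sum_insert ha]
    exact (hG a (Finset.mem_insert_self a s)).add
      (ih fun b hb => hG b (Finset.mem_insert_of_mem hb))

/-- At empirical measures `𝒮` is a finite average over reindexings of the data, so measurability in
the data points persists without any σ-algebra on `MomentMeasure`. -/
theorem resample (hG : Admissible N B G) : Admissible N B (resample N G) := by
  obtain ⟨C, hC⟩ := hG.bounded
  constructor
  · simp_rw [resample_empirical]
    refine (Finset.measurable_sum _ fun f _ => ?_).const_mul _
    exact hG.measurable.comp (measurable_pi_lambda _ fun i => measurable_pi_apply (f i))
  · refine ⟨((N : ℝ)⁻¹) ^ N * ∑ f : Fin N → Fin N, C, fun x hx => ?_⟩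
    rw [resample_empirical, abs_mul, abs_of_nonneg (by positivity : (0 : ℝ) ≤ ((N : ℝ)⁻¹) ^ N)]
    gcongr
    exact (Finset.abs_sum_le_sum_abs _ _).trans
      (Finset.sum_le_sum fun f _ => hC _ fun i => hx (f i))

theorem idSubResample (hG : Admissible N B G) : Admissible N B (idSubResample N G) :=
  hG.sub hG.resample

theorem idSubResample_iterate (hG : Admissible N B G) (j : ℕ) :
    Admissible N B ((BootstrapBias.idSubResample N)^[j] G) := by
  induction j with
  | zero => exact hG
  | succ j ih =>
    rw [Function.iterate_succ_apply']
    exact ih.idSubResample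

theorem iteratedBootstrap (hG : Admissible N B G) (j : ℕ) :
    Admissible N B (iteratedBootstrap N j G) := by
  induction j with
  | zero => exact hG
  | succ j ih =>
    rw [BootstrapBias.iteratedBootstrap, Function.iterate_succ_apply']
    exact hG.sub (ih.resample.sub ih)

end Admissible

variable {G H : MomentMeasure ι → ℝ} {X : MomentMeasure ι}

theorem resample_congr (h : ∀ X, SupportedIn B X → G X = H X) (hX : SupportedIn B X) :
    resample N G X = resample N H X :=
  integral_congr_ae (hX.ae_pi.mono fun _ hx => h _ (supportedIn_empirical hx))

theorem idSubResample_iterate_congr (h : ∀ X, SupportedIn B X → G X = H X) (j : ℕ) :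
    ∀ X, SupportedIn B X → (idSubResample N)^[j] G X = (idSubResample N)^[j] H X := by
  induction j with
  | zero => exact h
  | succ j ih =>
    intro X hX
    simp only [Function.iterate_succ_apply', idSubResample]
    rw [ih X hX, resample_congr ih hX]

theorem resample_add_const_mul (hG : Admissible N B G) (hH : Admissible N B H) (c : ℝ)
    (hX : SupportedIn B X) :
    resample N (fun X => G X + c * H X) X = resample N G X + c * resample N H X := by
  simp only [resample]
  rw [integral_add (hG.integrable hX) ((hH.integrable hX).const_mul c), integral_const_mul]

/-- Linearity is not automatic, as the Bochner integral is additive only on integrable functions;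
admissibility and support in `B` provide this at every stage. -/
theorem idSubResample_iterate_add_const_mul (hG : Admissible N B G) (hH : Admissible N B H)
    (c : ℝ) (j : ℕ) : ∀ X, SupportedIn B X →
      (idSubResample N)^[j] (fun X => G X + c * H X) X =
        (idSubResample N)^[j] G X + c * (idSubResample N)^[j] H X := by
  induction j with
  | zero => exact fun _ _ => rfl
  | succ j ih =>
    intro X hX
    simp only [Function.iterate_succ_apply']
    simp only [idSubResample]
    rw [ih X hX, resample_congr ih hX,
      resample_add_const_mul (hG.idSubResample_iterate j) (hH.idSubResample_iterate j) c hX]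
    ring

theorem idSubResample_iterate_zero (j : ℕ) :
    (idSubResample N)^[j] (fun _ : MomentMeasure ι => (0 : ℝ)) = fun _ => 0 := by
  induction j with
  | zero => rfl
  | succ j ih =>
    rw [Function.iterate_succ_apply', ih]
    funext X
    simp [idSubResample, resample]

theorem idSubResample_iterate_sum {α : Type*} (s : Finset α) (c : α → ℝ)
    {G : α → MomentMeasure ι → ℝ} (hG : ∀ a, Admissible N B (G a)) (j : ℕ)
    (hX : SupportedIn B X) :
    (idSubResample N)^[j] (fun X => ∑ a ∈ s, c a * G a X) X =
      ∑ a ∈ s, c a * (idSubResample N)^[j] (G a) X := by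
  classical
  induction s using Finset.induction_on with
  | empty => simp [idSubResample_iterate_zero]
  | insert a s ha ih =>
    simp_rw [Finset.sum_insert ha]
    rw [← ih, add_comm, ← idSubResample_iterate_add_const_mul
      (Admissible.sum s fun b _ => (hG b).const_mul (c b)) (hG a) (c a) j X hX]
    simp_rw [add_comm]

/-- `𝒮` is an average, so `Id - 𝒮` at most doubles a uniform bound. This crude estimate serves for
the Neumann tail. -/
theorem abs_idSubResample_iterate_le {C : ℝ} (h : ∀ X, SupportedIn B X → |G X| ≤ C) (j : ℕ) :
    ∀ X, SupportedIn B X → |(idSubResample N)^[j] G X| ≤ 2 ^ j * C := by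
  induction j with
  | zero => simpa using h
  | succ j ih =>
    intro X hX
    rw [Function.iterate_succ_apply', idSubResample]
    have h2 : |resample N ((idSubResample N)^[j] G) X| ≤ 2 ^ j * C := by
      have := norm_integral_le_of_norm_le_const (μ := Measure.pi fun _ : Fin N => X.1)
        (f := fun x => (idSubResample N)^[j] G (empirical x)) (C := 2 ^ j * C)
        (hX.ae_pi.mono fun x hx => ih _ (supportedIn_empirical hx))
      simpa [resample] using this
    calc _ ≤ _ := abs_sub _ _
      _ ≤ 2 ^ j * C + 2 ^ j * C := add_le_add (ih X hX) h2
      _ = _ := by ring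

/-- `ℬʲF = ∑_{i ≤ j} (Id - 𝒮)ⁱF`. -/
theorem iteratedBootstrap_eq_sum (hG : Admissible N B G) (j : ℕ) : ∀ X, SupportedIn B X →
    iteratedBootstrap N j G X = ∑ i ∈ Finset.range (j + 1), (idSubResample N)^[i] G X := by
  induction j with
  | zero => simp [iteratedBootstrap]
  | succ j ih =>
    intro X hX
    have h : resample N (iteratedBootstrap N j G) X =
        ∑ i ∈ Finset.range (j + 1), resample N ((idSubResample N)^[i] G) X := by
      rw [resample_congr ih hX]
      exact integral_finsetSum _ fun i _ => (hG.idSubResample_iterate i).integrable hX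
    have h2 : iteratedBootstrap N (j + 1) G X =
        G X - (resample N (iteratedBootstrap N j G) X - iteratedBootstrap N j G X) := by
      rw [iteratedBootstrap, Function.iterate_succ_apply']
      rfl
    -- The term `i = 0` is the `G X` added by `ℬ`; the others are `(Id - 𝒮)` applied to the previous
    -- sum.
    rw [h2, h, ih X hX, Finset.sum_range_succ' _ (j + 1), ← Finset.sum_sub_distrib]
    simp only [Function.iterate_succ_apply', idSubResample, Finset.sum_sub_distrib,
      Function.iterate_zero, id]
    ring

theorem bias_iteratedBootstrap (hG : Admissible N B G) (hX : SupportedIn B X) (k : ℕ) :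
    resample N (iteratedBootstrap N k G) X - G X = -(idSubResample N)^[k + 1] G X := by
  have h : resample N (iteratedBootstrap N k G) X =
      ∑ i ∈ Finset.range (k + 1), resample N ((idSubResample N)^[i] G) X := by
    rw [resample_congr (iteratedBootstrap_eq_sum hG k) hX]
    exact integral_finsetSum _ fun i _ => (hG.idSubResample_iterate i).integrable hX
  have h2 : ∀ i, resample N ((idSubResample N)^[i] G) X =
      (idSubResample N)^[i] G X - (idSubResample N)^[i + 1] G X := by
    intro i
    rw [Function.iterate_succ_apply', idSubResample]
    ring
  rw [h, Finset.sum_congr rfl fun i _ => h2 i, Finset.sum_range_sub']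
  simp

end BootstrapBias

end

/-! ### Functionals of finitely many samples: collisions and contraction. -/

noncomputable section

namespace BootstrapBias

variable {ι : Type} [Fintype ι] {N : ℕ} [NeZero N] {B : Set (ι → ℝ)} {m : ℕ}
  {h : (Fin m → ι → ℝ) → ℝ} {C : ℝ}

/-- Distinct members of an i.i.d. family are again i.i.d.: the pullback of a box is a box whose
additional sides are `univ`, of mass 1. -/
theorem map_comp_pi (X : MomentMeasure ι) {κ κ' : Type} [Fintype κ] [Fintype κ'] {e : κ → κ'}
    (he : Function.Injective e) :
    (Measure.pi fun _ : κ' => X.1).map (fun y => y ∘ e) = Measure.pi fun _ : κ => X.1 := by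
  classical
  have hm : Measurable fun y : κ' → ι → ℝ => y ∘ e :=
    measurable_pi_lambda _ fun i => measurable_pi_apply (e i)
  refine (Measure.pi_eq fun s hs => ?_).symm
  rw [Measure.map_apply hm (MeasurableSet.univ_pi hs)]
  have hpre : (fun y : κ' → ι → ℝ => y ∘ e) ⁻¹' Set.univ.pi s =
      Set.univ.pi (Function.extend e s fun _ => Set.univ) := by
    ext y
    simp only [Set.mem_preimage, Set.mem_univ_pi, Function.comp_apply]
    constructor
    · intro hy k
      by_cases hk : ∃ i, e i = k
      · obtain ⟨i, rfl⟩ := hk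
        rw [he.extend_apply]
        exact hy i
      · rw [Function.extend_apply' _ _ _ hk]
        trivial
    · intro hy i
      simpa [he.extend_apply] using hy (e i)
  rw [hpre, Measure.pi_pi]
  refine (Fintype.prod_of_injective e he _ _ (fun k hk => ?_) fun i => ?_).symm
  · rw [Function.extend_apply' _ _ _ hk]
    simp
  · rw [he.extend_apply]

/-- The functional `X ↦ 𝔼[h(y_{g(1)}, …, y_{g(m)})]`, where the `y_b` are independent samples of
`X`. -/
def sampleMean {κ : Type} [Fintype κ] (h : (Fin m → ι → ℝ) → ℝ) (g : Fin m → κ)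
    (X : MomentMeasure ι) : ℝ :=
  ∫ y, h (y ∘ g) ∂(Measure.pi fun _ : κ => X.1)

theorem sampleMean_comp {κ κ' : Type} [Fintype κ] [Fintype κ'] (hm : Measurable h)
    (g : Fin m → κ) {e : κ → κ'} (he : Function.Injective e) (X : MomentMeasure ι) :
    sampleMean h (e ∘ g) X = sampleMean h g X := by
  rw [sampleMean, sampleMean, ← map_comp_pi X he, integral_map]
  · rfl
  · exact (measurable_pi_lambda _ fun i => measurable_pi_apply (e i)).aemeasurable
  · exact (hm.comp (measurable_pi_lambda _ fun i => measurable_pi_apply (g i))).aestronglyMeasurable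

/-- Only the pattern of coincidences in `g` matters; both sides reduce to the samples indexed by
`Set.range g`. -/
theorem sampleMean_comp_of_injOn {κ κ' : Type} [Fintype κ] [Fintype κ'] (hm : Measurable h)
    (g : Fin m → κ) {f : κ → κ'} (hf : Set.InjOn f (Set.range g)) :
    sampleMean h (f ∘ g) = sampleMean h g := by
  classical
  funext X
  have h1 := sampleMean_comp hm (Set.rangeFactorization g)
    (e := (Subtype.val : Set.range g → κ)) Subtype.val_injective X
  have h2 := sampleMean_comp hm (Set.rangeFactorization g)
    (e := (f ∘ Subtype.val : Set.range g → κ')) hf.injective X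
  exact h2.trans h1.symm

theorem sampleMean_empirical {κ : Type} [Fintype κ] [DecidableEq κ] (g : Fin m → κ)
    (x : Fin N → ι → ℝ) :
    sampleMean h g (empirical x) =
      ((N : ℝ)⁻¹) ^ Fintype.card κ * ∑ f : κ → Fin N, h (x ∘ f ∘ g) :=
  integral_pi_empirical x κ _

theorem admissible_sampleMean {κ : Type} [Fintype κ] (hm : Measurable h)
    (hC : ∀ y, (∀ i, y i ∈ B) → |h y| ≤ C) (g : Fin m → κ) :
    Admissible N B (sampleMean h g) := by
  classical
  constructor
  · simp_rw [sampleMean_empirical]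
    refine (Finset.measurable_sum _ fun f _ => ?_).const_mul _
    exact hm.comp (measurable_pi_lambda _ fun i => measurable_pi_apply (f (g i)))
  · refine ⟨((N : ℝ)⁻¹) ^ Fintype.card κ * ∑ f : κ → Fin N, C, fun x hx => ?_⟩
    rw [sampleMean_empirical, abs_mul,
      abs_of_nonneg (by positivity : (0 : ℝ) ≤ ((N : ℝ)⁻¹) ^ Fintype.card κ)]
    gcongr
    exact (Finset.abs_sum_le_sum_abs _ _).trans
      (Finset.sum_le_sum fun f _ => hC _ fun i => hx (f (g i)))

theorem abs_sampleMean_le {κ : Type} [Fintype κ] (hC : ∀ y, (∀ i, y i ∈ B) → |h y| ≤ C)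
    (g : Fin m → κ) (X : MomentMeasure ι) (hX : SupportedIn B X) : |sampleMean h g X| ≤ C := by
  have := norm_integral_le_of_norm_le_const (μ := Measure.pi fun _ : κ => X.1)
    (f := fun y => h (y ∘ g)) (C := C) (hX.ae_pi.mono fun y hy => hC _ fun i => hy (g i))
  simpa [sampleMean] using this

/-- Sampling from an empirical measure means picking data points by a random `f`. Resampling thus
averages functionals of the same kind, with the same `h` and `m`. -/
theorem resample_sampleMean {κ : Type} [Fintype κ] [DecidableEq κ] (hm : Measurable h)
    (hC : ∀ y, (∀ i, y i ∈ B) → |h y| ≤ C) (g : Fin m → κ)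
    (X : MomentMeasure ι) (hX : SupportedIn B X) :
    resample N (sampleMean h g) X =
      ((N : ℝ)⁻¹) ^ Fintype.card κ * ∑ f : κ → Fin N, sampleMean h (f ∘ g) X := by
  rw [resample]
  simp_rw [sampleMean_empirical]
  rw [integral_const_mul, integral_finsetSum]
  · rfl
  · intro f _
    refine Integrable.of_bound (hm.comp (measurable_pi_lambda _ fun i =>
      measurable_pi_apply (f (g i)))).aestronglyMeasurable C (hX.ae_pi.mono fun x hx => ?_)
    exact hC _ fun i => hx (f (g i))

/-- Overwriting `f p` by an arbitrary value loses nothing, since `f p` is recovered from `f q`. -/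
theorem card_collision_mul_le {M : ℕ} {κ : Type} [Fintype κ] [DecidableEq κ] {p q : κ} (hpq : p ≠ q) :
    (Finset.univ.filter fun f : κ → Fin M => f p = f q).card * M ≤ M ^ Fintype.card κ := by
  have h := Finset.card_le_card_of_injOn
    (s := (Finset.univ.filter fun f : κ → Fin M => f p = f q) ×ˢ (Finset.univ : Finset (Fin M)))
    (t := (Finset.univ : Finset (κ → Fin M)))
    (fun z => Function.update z.1 p z.2) (fun _ _ => Finset.mem_coe.2 (Finset.mem_univ _)) (by
      rintro ⟨f, v⟩ hf ⟨f', v'⟩ hf' heq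
      simp only [Finset.coe_product, Set.mem_prod, Finset.mem_coe, Finset.mem_filter,
        Finset.mem_univ, true_and, and_true] at hf hf'
      have hv : v = v' := by simpa using congrFun heq p
      have hne : ∀ k, k ≠ p → f k = f' k := fun k hk => by
        simpa [Function.update_of_ne hk] using congrFun heq k
      have hff : f = f' := by
        funext k
        by_cases hk : k = p
        · rw [hk, hf, hf', hne q hpq.symm]
        · exact hne k hk
      rw [hff, hv])
  simpa [Finset.card_product] using h

open Classical in
/-- At most `m² / 2` pairs can collide, each with probability `1 / M`. -/
theorem card_not_injOn_range_le {M : ℕ} {κ : Type} [Fintype κ] (g : Fin m → κ) :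
    2 * (Finset.univ.filter fun f : κ → Fin M => ¬ Set.InjOn f (Set.range g)).card * M ≤
      m ^ 2 * M ^ Fintype.card κ := by
  set P : (κ → Fin M) → Fin m × Fin m → Prop :=
    fun f z => g z.1 ≠ g z.2 ∧ f (g z.1) = f (g z.2)
  -- Pairs are ordered, so each collision is counted twice; this gives the factor 2 on the left.
  have h1 : ∀ f : κ → Fin M, ¬ Set.InjOn f (Set.range g) →
      2 ≤ (Finset.univ.filter fun z => P f z).card := by
    intro f hf
    simp only [Set.InjOn, Set.mem_range] at hf
    push Not at hf
    obtain ⟨_, ⟨a, rfl⟩, _, ⟨b, rfl⟩, hab, hne⟩ := hf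
    have hab' : a ≠ b := fun h => hne (by rw [h])
    rw [← Finset.card_pair (a := (a, b)) (b := (b, a)) (by simp [hab'])]
    refine Finset.card_le_card fun z hz => ?_
    rw [Finset.mem_insert, Finset.mem_singleton] at hz
    rw [Finset.mem_filter]
    rcases hz with rfl | rfl
    · exact ⟨Finset.mem_univ _, hne, hab⟩
    · exact ⟨Finset.mem_univ _, hne.symm, hab.symm⟩
  have h2 : (Finset.univ.filter fun f : κ → Fin M => ¬ Set.InjOn f (Set.range g)).card * 2 ≤
      ∑ f : κ → Fin M, (Finset.univ.filter fun z => P f z).card := by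
    rw [← smul_eq_mul, ← Finset.sum_const]
    exact (Finset.sum_le_sum fun f hf => h1 f (Finset.mem_filter.1 hf).2).trans
      (Finset.sum_le_sum_of_subset (Finset.filter_subset _ _))
  have h3 : ∑ f : κ → Fin M, (Finset.univ.filter fun z => P f z).card =
      ∑ z : Fin m × Fin m, (Finset.univ.filter fun f : κ → Fin M => P f z).card :=
    Finset.sum_card_bipartiteAbove_eq_sum_card_bipartiteBelow P
  have h4 : ∀ z : Fin m × Fin m,
      (Finset.univ.filter fun f : κ → Fin M => P f z).card * M ≤ M ^ Fintype.card κ := by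
    intro z
    by_cases hz : g z.1 = g z.2
    · simp [P, hz]
    · simpa [P, hz] using card_collision_mul_le (M := M) hz
  calc _ ≤ (∑ z : Fin m × Fin m,
        (Finset.univ.filter fun f : κ → Fin M => P f z).card) * M :=
        Nat.mul_le_mul_right _ (by rw [mul_comm, ← h3]; exact h2)
    _ ≤ ∑ z : Fin m × Fin m, M ^ Fintype.card κ := by
        rw [Finset.sum_mul]
        exact Finset.sum_le_sum fun z _ => h4 z
    _ = _ := by simp [sq]

/-- `Id - 𝒮` averages the differences `D f`, which vanish unless `f` collides on the range of `g`.
The 2 from bounding a difference cancels the 1/2 in the collision probability. The induction varies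
`κ` because `𝒮` changes it to `Fin N`. -/
theorem abs_idSubResample_iterate_sampleMean_le (hm : Measurable h) (hC0 : 0 ≤ C)
    (hC : ∀ y, (∀ i, y i ∈ B) → |h y| ≤ C) (j : ℕ) :
    ∀ {κ : Type} [Fintype κ] (g : Fin m → κ) (X : MomentMeasure ι), SupportedIn B X →
      |(idSubResample N)^[j] (sampleMean h g) X| ≤ ((m : ℝ) ^ 2 / N) ^ j * C := by
  classical
  induction j with
  | zero =>
    intro κ _ g X hX
    simpa using abs_sampleMean_le hC g X hX
  | succ j ih =>
    intro κ _ g X hX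
    have hN : (N : ℝ) ≠ 0 := Nat.cast_ne_zero.2 (NeZero.ne N)
    set w : ℝ := ((N : ℝ)⁻¹) ^ Fintype.card κ with hw
    have hw1 : w * (N : ℝ) ^ Fintype.card κ = 1 := by
      rw [hw, ← mul_pow, inv_mul_cancel₀ hN, one_pow]
    have hw0 : 0 ≤ w := by positivity
    set D : (κ → Fin N) → MomentMeasure ι → ℝ :=
      fun f X => sampleMean h g X - sampleMean h (f ∘ g) X with hD
    have hadm : ∀ {κ : Type} [Fintype κ] (g : Fin m → κ), Admissible N B (sampleMean h g) :=
      fun g => admissible_sampleMean hm hC g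
    have hstep : ∀ X, SupportedIn B X →
        idSubResample N (sampleMean h g) X = ∑ f : κ → Fin N, w * D f X := by
      intro X hX
      rw [idSubResample, resample_sampleMean hm hC g X hX]
      simp only [hD, mul_sub, Finset.sum_sub_distrib, ← Finset.mul_sum, Finset.sum_const,
        Finset.card_univ, Fintype.card_fun, Fintype.card_fin, nsmul_eq_mul]
      push_cast
      rw [← mul_assoc, hw1, one_mul]
    have hDj : ∀ f, (idSubResample N)^[j] (D f) X =
        (idSubResample N)^[j] (sampleMean h g) X -
          (idSubResample N)^[j] (sampleMean h (f ∘ g)) X := by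
      intro f
      have := idSubResample_iterate_add_const_mul (N := N) (hadm g) (hadm (f ∘ g)) (-1) j X hX
      simpa [hD, sub_eq_add_neg] using this
    set c : ℝ := ((m : ℝ) ^ 2 / N) ^ j * C with hc
    have hc0 : 0 ≤ c := by positivity
    have hbound : ∀ f, |(idSubResample N)^[j] (D f) X| ≤
        if ¬ Set.InjOn f (Set.range g) then 2 * c else 0 := by
      intro f
      rw [hDj]
      split_ifs with hf
      · rw [sampleMean_comp_of_injOn hm g hf]
        simp
      · refine (abs_sub _ _).trans ?_
        rw [two_mul]
        exact add_le_add (ih g X hX) (ih (f ∘ g) X hX)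
    have hcard : 2 * ((Finset.univ.filter fun f : κ → Fin N =>
        ¬ Set.InjOn f (Set.range g)).card : ℝ) * N ≤ (m : ℝ) ^ 2 * (N : ℝ) ^ Fintype.card κ := by
      exact_mod_cast card_not_injOn_range_le (M := N) g
    -- The innermost application is expanded, leaving `j` iterates on each `D f` for the induction
    -- hypothesis.
    rw [Function.iterate_succ_apply, idSubResample_iterate_congr hstep j X hX,
      idSubResample_iterate_sum _ _ (fun f => (hadm g).sub (hadm (f ∘ g))) j hX, ← Finset.mul_sum,
      abs_mul, abs_of_nonneg hw0]
    calc _ ≤ w * ∑ f : κ → Fin N, if ¬ Set.InjOn f (Set.range g) then 2 * c else 0 := by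
          gcongr
          exact (Finset.abs_sum_le_sum_abs _ _).trans (Finset.sum_le_sum fun f _ => hbound f)
      _ = w * (2 * ((Finset.univ.filter fun f : κ → Fin N =>
            ¬ Set.InjOn f (Set.range g)).card : ℝ) * N) * (c / N) := by
          rw [← Finset.sum_filter, Finset.sum_const, nsmul_eq_mul]
          field_simp
      _ ≤ w * ((m : ℝ) ^ 2 * (N : ℝ) ^ Fintype.card κ) * (c / N) := by
          gcongr
      _ = (w * (N : ℝ) ^ Fintype.card κ) * ((m : ℝ) ^ 2 / N * c) := by ring
      _ = _ := by rw [hw1, hc]; ring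

end BootstrapBias

end

/-! ### Spectral norm bounds and the Neumann series of the trace functional. -/

noncomputable section

namespace BootstrapBias

open scoped Matrix.Norms.L2Operator

variable {n : ℕ}

theorem norm_le_of_hasEigenvalue {A : Matrix (Fin n) (Fin n) ℝ} (hA : A.IsSymm) {r : ℝ}
    (hr : 0 ≤ r) (h : ∀ lam : ℝ, Module.End.HasEigenvalue (Matrix.toLin' A) lam → |lam| ≤ r) :
    ‖A‖ ≤ r := by
  have hH : A.IsHermitian := by
    rw [Matrix.IsHermitian, Matrix.conjTranspose_eq_transpose_of_trivial]
    exact hA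
  have hnorm : ‖A‖ = ‖hH.eigenvalues‖ := by
    conv_lhs => rw [hH.spectral_theorem]
    rw [Unitary.conjStarAlgAut_apply, ← Unitary.coe_star, CStarRing.norm_mul_coe_unitary,
      CStarRing.norm_coe_unitary_mul, Matrix.l2_opNorm_diagonal]
    rfl
  rw [hnorm, pi_norm_le_iff_of_nonneg hr]
  intro i
  refine h _ ?_
  rw [Module.End.hasEigenvalue_iff_mem_spectrum, Matrix.spectrum_toLin']
  exact hH.eigenvalues_mem_spectrum_real i

theorem abs_apply_le_norm (A : Matrix (Fin n) (Fin n) ℝ) (i j : Fin n) : |A i j| ≤ ‖A‖ := by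
  have h := Matrix.l2_opNorm_mulVec A (EuclideanSpace.single j (1 : ℝ))
  rw [PiLp.norm_single, norm_one, mul_one] at h
  have h2 := PiLp.norm_apply_le (WithLp.toLp 2 (A.mulVec (EuclideanSpace.single j (1 : ℝ)).ofLp) :
    EuclideanSpace ℝ (Fin n)) i
  refine le_trans (le_of_eq ?_) (h2.trans h)
  simp

theorem abs_normalizedTrace_le_norm (A : Matrix (Fin n) (Fin n) ℝ) :
    |normalizedTrace A| ≤ ‖A‖ := by
  rw [normalizedTrace, Matrix.trace, abs_mul, abs_inv, Nat.abs_cast]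
  have h : |∑ i, A.diag i| ≤ n * ‖A‖ :=
    (Finset.abs_sum_le_sum_abs _ _).trans <|
      (Finset.sum_le_sum fun i _ => abs_apply_le_norm A i i).trans (by simp)
  calc _ ≤ (n : ℝ)⁻¹ * (n * ‖A‖) := by gcongr
    _ ≤ 1 * ‖A‖ := by
      rw [← mul_assoc]
      exact mul_le_mul_of_nonneg_right inv_mul_le_one (norm_nonneg _)
    _ = ‖A‖ := one_mul _

/-- Only an inequality, because `n = 0` is allowed here. -/
theorem norm_one_matrix_le : ‖(1 : Matrix (Fin n) (Fin n) ℝ)‖ ≤ 1 := by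
  rw [← Matrix.diagonal_one, Matrix.l2_opNorm_diagonal]
  exact (pi_norm_le_iff_of_nonneg zero_le_one).2 (by simp)

theorem norm_pow_matrix_le {A : Matrix (Fin n) (Fin n) ℝ} {r : ℝ} (hA : ‖A‖ ≤ r) (m : ℕ) :
    ‖A ^ m‖ ≤ r ^ m := by
  rcases Nat.eq_zero_or_pos m with rfl | hm
  · simpa using norm_one_matrix_le
  · exact (norm_pow_le' A hm).trans (pow_le_pow_left₀ (norm_nonneg _) hA m)

/-- The finite geometric sum gives an exact remainder, and the norm bound follows from `Q = 1 - A *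
Q` for the inverse `Q`. -/
theorem inv_one_add_eq_sum {A : Matrix (Fin n) (Fin n) ℝ} {r : ℝ} (hA : ‖A‖ ≤ r) (hr : r < 1)
    (m : ℕ) :
    (1 + A)⁻¹ = ∑ i ∈ Finset.range m, (-A) ^ i + (1 + A)⁻¹ * (-A) ^ m ∧
      ‖(1 + A)⁻¹‖ ≤ 1 / (1 - r) := by
  have hU : IsUnit (1 + A) := by
    have := isUnit_one_sub_of_norm_lt_one (x := -A) (by rw [norm_neg]; linarith)
    rwa [sub_neg_eq_add] at this
  have hdet := (Matrix.isUnit_iff_isUnit_det _).1 hU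
  constructor
  · have h := mul_neg_geom_sum (-A) m
    rw [sub_neg_eq_add] at h
    have h2 := congrArg ((1 + A)⁻¹ * ·) h
    simp only [← mul_assoc, Matrix.nonsing_inv_mul _ hdet, one_mul, mul_sub, mul_one] at h2
    rw [h2]
    abel
  · have h := Matrix.mul_nonsing_inv _ hdet
    set Q := (1 + A)⁻¹
    have hQ : Q = 1 - A * Q := by
      rw [add_mul, one_mul] at h
      rw [← h]
      abel
    have h2 : ‖Q‖ ≤ 1 + r * ‖Q‖ := by
      calc ‖Q‖ = ‖1 - A * Q‖ := by rw [← hQ]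
        _ ≤ ‖(1 : Matrix (Fin n) (Fin n) ℝ)‖ + ‖A * Q‖ := norm_sub_le _ _
        _ ≤ 1 + r * ‖Q‖ := by
          gcongr
          · exact norm_one_matrix_le
          · exact (norm_mul_le _ _).trans (by gcongr)
    rw [le_div_iff₀ (by linarith)]
    linarith

theorem integrable_apply {ι : Type} [Fintype ι] (X : MomentMeasure ι) (i : ι) :
    Integrable (fun x => x i) X.1 := by
  have h := X.2.2 1
  simp only [pow_one] at h
  exact h.mono (measurable_pi_apply i).aestronglyMeasurable
    (ae_of_all _ fun x => by simpa using norm_le_pi_norm x i)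

/-- The points of `ℝ^(n²)` which are matrices of spectral norm at most `r`. -/
def matrixBall (n : ℕ) (r : ℝ) : Set (Fin n × Fin n → ℝ) := {x | ‖toMatrix x‖ ≤ r}

theorem continuous_toMatrix : Continuous (toMatrix : (Fin n × Fin n → ℝ) → _) :=
  continuous_matrix fun i j => continuous_apply (i, j)

theorem toMatrix_mean (X : MomentMeasure (Fin n × Fin n)) :
    toMatrix (∫ x, x ∂X.1) = meanMatrix X := by
  ext i j
  exact eval_integral (integrable_apply X) (i, j)

/-- The spectral norm ball is closed and convex, so it contains the mean. -/
theorem norm_meanMatrix_le {r : ℝ} {X : MomentMeasure (Fin n × Fin n)}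
    (hX : SupportedIn (matrixBall n r) X) : ‖meanMatrix X‖ ≤ r := by
  rw [← toMatrix_mean]
  have hconv : Convex ℝ (matrixBall n r) := by
    intro x hx y hy a b ha hb hab
    have : toMatrix (a • x + b • y) = a • toMatrix x + b • toMatrix y := rfl
    rw [matrixBall, Set.mem_ofPred_eq, this]
    calc _ ≤ ‖a • toMatrix x‖ + ‖b • toMatrix y‖ := norm_add_le _ _
      _ = a * ‖toMatrix x‖ + b * ‖toMatrix y‖ := by
        rw [norm_smul, norm_smul, Real.norm_of_nonneg ha, Real.norm_of_nonneg hb]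
      _ ≤ a * r + b * r := by
        gcongr
        · exact hx
        · exact hy
      _ = r := by rw [← add_mul, hab, one_mul]
  have hclosed : IsClosed (matrixBall n r) :=
    isClosed_le (continuous_norm.comp continuous_toMatrix) continuous_const
  exact hconv.integral_mem hclosed hX (Integrable.of_eval (integrable_apply X))

/-- The product of the matrices `y₁, …, y_m`. -/
def matrixProd : {m : ℕ} → (Fin m → Fin n × Fin n → ℝ) → Matrix (Fin n) (Fin n) ℝ
  | 0, _ => 1
  | _ + 1, y => toMatrix (y 0) * matrixProd (Fin.tail y)

theorem continuous_matrixProd (m : ℕ) :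
    Continuous (matrixProd : (Fin m → Fin n × Fin n → ℝ) → _) := by
  induction m with
  | zero => exact continuous_const
  | succ m ih =>
    exact (continuous_toMatrix.comp (continuous_apply 0)).matrix_mul
      (ih.comp (continuous_pi fun i => continuous_apply i.succ))

theorem norm_matrixProd_le {r : ℝ} {m : ℕ} (y : Fin m → Fin n × Fin n → ℝ)
    (hy : ∀ i, y i ∈ matrixBall n r) : ‖matrixProd y‖ ≤ r ^ m := by
  induction m with
  | zero => simpa [matrixProd] using norm_one_matrix_le
  | succ m ih =>
    rw [matrixProd, pow_succ']
    have h0 : ‖toMatrix (y 0)‖ ≤ r := hy 0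
    exact (norm_mul_le _ _).trans (mul_le_mul h0 (ih (Fin.tail y) fun i => hy i.succ)
      (norm_nonneg _) ((norm_nonneg _).trans h0))

/-- By independence the first factor splits off via Fubini. Integrability is carried along in the
induction. -/
theorem integral_matrixProd (X : MomentMeasure (Fin n × Fin n)) (m : ℕ) : ∀ i j : Fin n,
    Integrable (fun y : Fin m → Fin n × Fin n → ℝ => matrixProd y i j)
      (Measure.pi fun _ => X.1) ∧
    ∫ y : Fin m → Fin n × Fin n → ℝ, matrixProd y i j ∂(Measure.pi fun _ => X.1) =
      (meanMatrix X ^ m) i j := by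
  induction m with
  | zero => simp [matrixProd]
  | succ m ih =>
    intro i j
    have hmp := (measurePreserving_piFinSuccAbove (fun _ : Fin (m + 1) => X.1) 0).symm
    have hcomp : ∀ z : (Fin n × Fin n → ℝ) × (Fin m → Fin n × Fin n → ℝ),
        matrixProd ((MeasurableEquiv.piFinSuccAbove (fun _ : Fin (m + 1) => Fin n × Fin n → ℝ)
          0).symm z) i j = ∑ l, toMatrix z.1 i l * matrixProd z.2 l j := by
      intro z
      rw [MeasurableEquiv.piFinSuccAbove_symm_apply]
      simp [Fin.insertNthEquiv, matrixProd, Matrix.mul_apply]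
    have hint : ∀ l, Integrable (fun z : (Fin n × Fin n → ℝ) × (Fin m → Fin n × Fin n → ℝ) =>
        toMatrix z.1 i l * matrixProd z.2 l j) (X.1.prod (Measure.pi fun _ => X.1)) :=
      fun l => Integrable.mul_prod (integrable_apply X (i, l)) (ih l j).1
    constructor
    · rw [← hmp.integrable_comp_emb (MeasurableEquiv.measurableEmbedding _)]
      refine (integrable_finsetSum Finset.univ fun l _ => hint l).congr (ae_of_all _ fun z => ?_)
      exact (hcomp z).symm
    · rw [← hmp.integral_comp']
      simp_rw [hcomp]
      refine (integral_finsetSum Finset.univ fun l _ => hint l).trans ?_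
      rw [pow_succ', Matrix.mul_apply]
      refine Finset.sum_congr rfl fun l _ => ?_
      refine (integral_prod_mul (fun x => toMatrix x i l) (fun y => matrixProd y l j)).trans ?_
      rw [(ih l j).2]
      rfl

/-- The normalized trace of the product of the matrices `y₁, …, y_m`. -/
def traceProd {m : ℕ} (y : Fin m → Fin n × Fin n → ℝ) : ℝ := normalizedTrace (matrixProd y)

theorem continuous_normalizedTrace :
    Continuous (normalizedTrace : Matrix (Fin n) (Fin n) ℝ → ℝ) :=
  continuous_const.mul continuous_id.matrix_trace

theorem measurable_traceProd (m : ℕ) :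
    Measurable (traceProd : (Fin m → Fin n × Fin n → ℝ) → ℝ) :=
  (continuous_normalizedTrace.comp (continuous_matrixProd m)).measurable

theorem abs_traceProd_le {r : ℝ} {m : ℕ} (y : Fin m → Fin n × Fin n → ℝ)
    (hy : ∀ i, y i ∈ matrixBall n r) : |traceProd y| ≤ r ^ m :=
  (abs_normalizedTrace_le_norm _).trans (norm_matrixProd_le y hy)

theorem sampleMean_traceProd (m : ℕ) (X : MomentMeasure (Fin n × Fin n)) :
    sampleMean traceProd (id : Fin m → Fin m) X = normalizedTrace (meanMatrix X ^ m) := by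
  simp only [sampleMean, Function.comp_id, traceProd, normalizedTrace, Matrix.trace,
    Matrix.diag_apply]
  rw [integral_const_mul, integral_finsetSum _ fun i _ => (integral_matrixProd X m i i).1]
  simp_rw [(integral_matrixProd X m _ _).2]

theorem meanMatrix_empirical {N : ℕ} [NeZero N] (x : Fin N → Fin n × Fin n → ℝ) :
    meanMatrix (empirical x) = (N : ℝ)⁻¹ • ∑ l, toMatrix (x l) := by
  ext i j
  simp only [meanMatrix, Matrix.of_apply, Matrix.smul_apply, Matrix.sum_apply]
  change ∫ z, toMatrix z i j ∂(empiricalMeasure x) = _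
  rw [empiricalMeasure, integral_smul_measure, integral_finsetSum_measure]
  · simp
  · intro f _
    exact integrable_dirac (by simp)

theorem abs_traceInverse_le {r : ℝ} (hr : r < 1) {X : MomentMeasure (Fin n × Fin n)}
    (hX : SupportedIn (matrixBall n r) X) : |traceInverse X| ≤ 1 / (1 - r) :=
  (abs_normalizedTrace_le_norm _).trans (inv_one_add_eq_sum (norm_meanMatrix_le hX) hr 0).2

theorem admissible_traceInverse {r : ℝ} (hr : r < 1) (N : ℕ) [NeZero N] :
    Admissible N (matrixBall n r) traceInverse := by
  refine ⟨?_, 1 / (1 - r), fun x hx => abs_traceInverse_le hr (supportedIn_empirical hx)⟩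
  have hM : Continuous fun x : Fin N → Fin n × Fin n → ℝ => 1 + meanMatrix (empirical x) := by
    simp_rw [meanMatrix_empirical]
    refine continuous_matrix fun i j => ?_
    simp only [Matrix.add_apply, Matrix.smul_apply, Matrix.sum_apply, toMatrix, Matrix.of_apply,
      smul_eq_mul]
    fun_prop
  -- Cramer's formula gives measurability everywhere, with `0⁻¹ = 0` at singular matrices.
  simp only [traceInverse, normalizedTrace, Matrix.inv_def, Matrix.trace_smul,
    Ring.inverse_eq_inv', smul_eq_mul]
  exact (hM.matrix_det.measurable.inv.mul hM.matrix_adjugate.matrix_trace.measurable).const_mul _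

theorem normalizedTrace_add (A C : Matrix (Fin n) (Fin n) ℝ) :
    normalizedTrace (A + C) = normalizedTrace A + normalizedTrace C := by
  rw [normalizedTrace, Matrix.trace_add, mul_add]
  rfl

/-- Truncation of the Neumann series of `traceInverse`. -/
theorem abs_traceInverse_sub_sum_le {r : ℝ} (hr : r < 1) (R : ℕ) {X : MomentMeasure (Fin n × Fin n)}
    (hX : SupportedIn (matrixBall n r) X) :
    |traceInverse X - ∑ m ∈ Finset.range R,
      (-1) ^ m * sampleMean traceProd (id : Fin m → Fin m) X| ≤ r ^ R / (1 - r) := by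
  obtain ⟨h1, h2⟩ := inv_one_add_eq_sum (norm_meanMatrix_le hX) hr R
  have hsum : ∑ m ∈ Finset.range R, (-1) ^ m * sampleMean traceProd (id : Fin m → Fin m) X =
      normalizedTrace (∑ m ∈ Finset.range R, (-meanMatrix X) ^ m) := by
    rw [normalizedTrace, Matrix.trace_sum, Finset.mul_sum]
    refine Finset.sum_congr rfl fun m _ => ?_
    rw [sampleMean_traceProd, normalizedTrace, ← neg_one_smul ℝ (meanMatrix X), smul_pow,
      Matrix.trace_smul, smul_eq_mul]
    ring
  rw [hsum, traceInverse]
  nth_rw 1 [h1]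
  rw [normalizedTrace_add, add_sub_cancel_left]
  refine (abs_normalizedTrace_le_norm _).trans ((norm_mul_le _ _).trans ?_)
  have h3 : ‖(-meanMatrix X) ^ R‖ ≤ r ^ R :=
    norm_pow_matrix_le (by rw [norm_neg]; exact norm_meanMatrix_le hX) R
  calc _ ≤ 1 / (1 - r) * r ^ R := mul_le_mul h2 h3 (norm_nonneg _) ((norm_nonneg _).trans h2)
    _ = _ := by ring

end BootstrapBias

end

/-! ### Choice of the truncation and of `k`, and the final bound. -/

noncomputable section

namespace BootstrapBias

theorem abs_idSubResample_iterate_traceInverse_le {n N : ℕ} [NeZero N] {r : ℝ} (hr0 : 0 < r)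
    (hr1 : r < 1) {X : MomentMeasure (Fin n × Fin n)} (hX : SupportedIn (matrixBall n r) X)
    {R : ℕ} (hR : ∀ m < R, (m : ℝ) ^ 2 / N ≤ 1 / 2) (j : ℕ) :
    |(idSubResample N)^[j] traceInverse X| ≤ ((1 / 2) ^ j + 2 ^ j * r ^ R) / (1 - r) := by
  have hr : 0 < 1 - r := by linarith
  set φ : ℕ → MomentMeasure (Fin n × Fin n) → ℝ :=
    fun m => sampleMean traceProd (id : Fin m → Fin m)
  have hφ : ∀ m, Admissible N (matrixBall n r) (φ m) := fun m =>
    admissible_sampleMean (measurable_traceProd m) (fun y hy => abs_traceProd_le y hy) _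
  set P : MomentMeasure (Fin n × Fin n) → ℝ :=
    fun X => ∑ m ∈ Finset.range R, (-1) ^ m * φ m X
  have hP : Admissible N (matrixBall n r) P :=
    Admissible.sum _ fun m _ => (hφ m).const_mul _
  have hF := admissible_traceInverse (n := n) hr1 N
  have hsplit : (idSubResample N)^[j] traceInverse X =
      (idSubResample N)^[j] (fun X => traceInverse X - P X) X + (idSubResample N)^[j] P X := by
    have h := idSubResample_iterate_add_const_mul (hF.sub hP) hP 1 j X hX
    simpa using h
  have hrem : |(idSubResample N)^[j] (fun X => traceInverse X - P X) X| ≤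
      2 ^ j * (r ^ R / (1 - r)) :=
    abs_idSubResample_iterate_le (fun X hX => abs_traceInverse_sub_sum_le hr1 R hX) j X hX
  have hgeom : ∑ m ∈ Finset.range R, r ^ m ≤ 1 / (1 - r) := by
    rw [le_div_iff₀ hr, geom_sum_mul_neg]
    linarith [pow_pos hr0 R]
  have hmain : |(idSubResample N)^[j] P X| ≤ (1 / 2) ^ j * (1 / (1 - r)) := by
    rw [idSubResample_iterate_sum _ _ hφ j hX]
    calc _ ≤ ∑ m ∈ Finset.range R, (1 / 2) ^ j * r ^ m := by
          refine (Finset.abs_sum_le_sum_abs _ _).trans (Finset.sum_le_sum fun m hm => ?_)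
          rw [abs_mul, abs_pow, abs_neg, abs_one, one_pow, one_mul]
          refine (abs_idSubResample_iterate_sampleMean_le (measurable_traceProd m)
            (pow_nonneg hr0.le m) (fun y hy => abs_traceProd_le y hy) j _ X hX).trans ?_
          exact mul_le_mul_of_nonneg_right
            (pow_le_pow_left₀ (by positivity) (hR m (Finset.mem_range.1 hm)) j)
            (pow_nonneg hr0.le m)
      _ ≤ _ := by
          rw [← Finset.mul_sum]
          gcongr
  rw [hsplit]
  calc _ ≤ _ := abs_add_le _ _
    _ ≤ 2 ^ j * (r ^ R / (1 - r)) + (1 / 2) ^ j * (1 / (1 - r)) := add_le_add hrem hmain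
    _ = _ := by ring

/-- With `a = -√(N/8) log σ`, the target power is `exp(-a/2)` and `σᴿ ≤ exp(-2a)`. The first term
uses `k + 1 > a` and `log 2 > 1/2`; the second uses `k ≤ a` and `log 2 < 1`, and is at most `2
exp(-a)`. -/
theorem half_pow_add_two_pow_mul_le {N k R : ℕ} {σ : ℝ} (hσ0 : 0 < σ) (hσ1 : σ < 1)
    (hk : k = ⌊-√((N : ℝ) / 8) * Real.log σ⌋₊) (hR : √((N : ℝ) / 2) ≤ R) :
    (1 / 2 : ℝ) ^ (k + 1) + 2 ^ (k + 1) * σ ^ R ≤ 3 * σ ^ √((N : ℝ) / 32) := by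
  set a : ℝ := -√((N : ℝ) / 8) * Real.log σ
  have hlog : Real.log σ < 0 := Real.log_neg hσ0 hσ1
  have ha : 0 ≤ a := mul_nonneg_of_nonpos_of_nonpos (neg_nonpos.2 (Real.sqrt_nonneg _)) hlog.le
  have hka : (k : ℝ) ≤ a := hk ▸ Nat.floor_le ha
  have hak : a < k + 1 := by exact_mod_cast hk ▸ Nat.lt_floor_add_one a
  have h32 : √((N : ℝ) / 32) = √((N : ℝ) / 8) / 2 := by
    rw [show (N : ℝ) / 32 = N / 8 / 2 ^ 2 by ring, Real.sqrt_div' _ (by positivity),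
      Real.sqrt_sq (by norm_num)]
  have h2 : √((N : ℝ) / 2) = 2 * √((N : ℝ) / 8) := by
    rw [show (N : ℝ) / 2 = 2 ^ 2 * (N / 8) by ring, Real.sqrt_mul (by positivity),
      Real.sqrt_sq (by norm_num)]
  have hσ : σ ^ √((N : ℝ) / 32) = Real.exp (-a / 2) := by
    rw [Real.rpow_def_of_pos hσ0, h32]
    congr 1
    simp only [a]
    ring
  have hσR : σ ^ R ≤ Real.exp (-(2 * a)) := by
    rw [← Real.rpow_natCast, Real.rpow_def_of_pos hσ0, Real.exp_le_exp]
    have := mul_le_mul_of_nonpos_left hR hlog.le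
    rw [h2] at this
    refine this.trans (le_of_eq ?_)
    simp only [a]
    ring
  have hl1 : 1 / 2 < Real.log 2 := by linarith [Real.log_two_gt_d9]
  have hl2 : Real.log 2 < 1 := by linarith [Real.log_two_lt_d9]
  have hpow : ∀ i : ℕ, (2 : ℝ) ^ i = Real.exp (Real.log 2 * i) := fun i => by
    rw [← Real.rpow_natCast, Real.rpow_def_of_pos two_pos]
  have hfirst : (1 / 2 : ℝ) ^ (k + 1) ≤ Real.exp (-a / 2) := by
    rw [one_div, inv_pow, hpow, ← Real.exp_neg, Real.exp_le_exp]
    push_cast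
    nlinarith
  have hsecond : (2 : ℝ) ^ (k + 1) * σ ^ R ≤ 2 * Real.exp (-a / 2) := by
    have hk2 : (2 : ℝ) ^ k ≤ Real.exp a := by
      rw [hpow, Real.exp_le_exp]
      nlinarith
    calc (2 : ℝ) ^ (k + 1) * σ ^ R = 2 * (2 ^ k * σ ^ R) := by ring
      _ ≤ 2 * (Real.exp a * Real.exp (-(2 * a))) := by gcongr
      _ ≤ 2 * Real.exp (-a / 2) := by
        rw [← Real.exp_add]
        gcongr
        linarith
  rw [hσ]
  linarith

theorem supportedIn_matrixBall {n : ℕ} {σ : ℝ} (hσ0 : 0 < σ) {X : MomentMeasure (Fin n × Fin n)}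
    (hX : ∀ᵐ x ∂X.1, (toMatrix x).IsSymm ∧
      ∀ lam : ℝ, Module.End.HasEigenvalue (Matrix.toLin' (toMatrix x)) lam →
        lam ∈ Set.Ioo 0 σ) :
    SupportedIn (matrixBall n σ) X := by
  refine hX.mono fun x hx => norm_le_of_hasEigenvalue hx.1 hσ0.le fun lam hlam => ?_
  rw [abs_of_pos (hx.2 lam hlam).1]
  exact (hx.2 lam hlam).2.le

end BootstrapBias

end

theorem mainTheorem11 (n N : ℕ) (hn : 1 ≤ n) [NeZero N] (σ : ℝ) (hσ0 : 0 < σ) (hσ1 : σ < 1)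
    (X : BootstrapBias.MomentMeasure (Fin n × Fin n))
    (hX : ∀ᵐ x ∂X.1, (BootstrapBias.toMatrix x).IsSymm ∧
      ∀ lam : ℝ, Module.End.HasEigenvalue (Matrix.toLin' (BootstrapBias.toMatrix x)) lam →
        lam ∈ Set.Ioo 0 σ)
    (k : ℕ) (hk : k = ⌊-√((N : ℝ) / 8) * Real.log σ⌋₊) :
    -- the expectations below exist
    (∀ j ≤ k, Integrable
      (fun x => (BootstrapBias.idSubResample N)^[j] BootstrapBias.traceInverse
        (BootstrapBias.empirical x)) (Measure.pi fun _ : Fin N => X.1)) ∧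
    (∀ j ≤ k, Integrable
      (fun x => BootstrapBias.iteratedBootstrap N j BootstrapBias.traceInverse
        (BootstrapBias.empirical x)) (Measure.pi fun _ : Fin N => X.1)) ∧
    -- the bias of the `k`-times iterated bootstrap is `-(Id - 𝒮)^(k+1) F`
    BootstrapBias.resample N (BootstrapBias.iteratedBootstrap N k BootstrapBias.traceInverse) X
        - BootstrapBias.traceInverse X =
      -(BootstrapBias.idSubResample N)^[k + 1] BootstrapBias.traceInverse X ∧
    -- the bound
    |(BootstrapBias.idSubResample N)^[k + 1] BootstrapBias.traceInverse X| ≤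
      4 / (1 - σ) * σ ^ √((N : ℝ) / 32) := by
  have hS := BootstrapBias.supportedIn_matrixBall hσ0 hX
  have hF := BootstrapBias.admissible_traceInverse (n := n) hσ1 N
  refine ⟨fun j _ => (hF.idSubResample_iterate j).integrable hS,
    fun j _ => (hF.iteratedBootstrap j).integrable hS,
    BootstrapBias.bias_iteratedBootstrap hF hS k, ?_⟩
  have hN : (0 : ℝ) < N := Nat.cast_pos.2 (Nat.pos_of_ne_zero (NeZero.ne N))
  -- An integer below the ceiling is below `√(N/2)` itself, so every retained degree contracts by
  -- 1/2.
  have hR : ∀ m < ⌈√((N : ℝ) / 2)⌉₊, (m : ℝ) ^ 2 / N ≤ 1 / 2 := by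
    intro m hm
    have h := (Real.lt_sqrt (Nat.cast_nonneg m)).1 (Nat.lt_ceil.1 hm)
    rw [div_le_iff₀ hN]
    linarith
  refine (BootstrapBias.abs_idSubResample_iterate_traceInverse_le hσ0 hσ1 hS hR (k + 1)).trans ?_
  have hσ : 0 < 1 - σ := by linarith
  have h := BootstrapBias.half_pow_add_two_pow_mul_le hσ0 hσ1 hk (Nat.le_ceil √((N : ℝ) / 2))
  have hpos := Real.rpow_pos_of_pos hσ0 √((N : ℝ) / 32)
  rw [div_mul_eq_mul_div]
  gcongr
  -- The estimate holds with 3; positivity of the power relaxes it to 4.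
  linarith
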